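/- Let $\mu$ be a Borel probability measure on $\mathbb R^n$ with a log-concave density $\rho$ (that is, $\rho\ge 0$ and $-\log\rho:\mathbb R^n\to(-\infty,\infty]$ is convex) and with barycenter at the origin. Let $$\Lambda_\mu(\xi)=\log\int_{\mathbb R^n} e^{\langle \xi,y\rangle}\,d\mu(y)\in(-\infty,\infty],\qquad \Lambda_p(\mu)=\{\Lambda_\mu\le p\}\cap-\{\Lambda_\mu\le p\}\quad(p\ge 0),$$ and, for $p\ge 1$, let $Z_p(\mu)\subset\mathbb R^n$ be the convex body with supporting functional $h_{Z_p(\mu)}(\theta)=\left(\int_{\mathbb R^n}|\langle y,\theta\rangle|^p\,d\mu(y)\right)^{1/p}$, i.e. $Z_p(\mu)=\{z:\langle z,\theta\rangle\le h_{Z_p(\mu)}(\theta)\ \text{for all }\theta\in\mathbb R^n\}$. For $x$ with $\Lambda_\mu(x)<\infty$, let the tilt $\mu_x$ be the probability measure obtained from the one with density $\rho(y)e^{\langle x,y\rangle}/\int\rho(u)e^{\langle x,u\rangle}\,du$ by the translation that moves its barycenter to the origin. There are universal constants $c,C,c',C'>0$ (independent of $n$, $\mu$, $p$ and $x$) such that: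 1. for every $p\ge 0$ and every $x\in\frac12\Lambda_p(\mu)$, $\quad c\,\Lambda_p(\mu_x)\subseteq\Lambda_p(\mu)\subseteq C\,\Lambda_p(\mu_x)$; 2. for every $p\ge 1$ and every $x\in\frac12\Lambda_p(\mu)$, $\quad c'\,Z_p(\mu_x)\subseteq Z_p(\mu)\subseteq C'\,Z_p(\mu_x)$. -/

import Mathlib

open scoped Pointwise

noncomputable section

namespace LogConcaveTilt

open MeasureTheory

/-- A nonnegative function `ρ` is log-concave, i.e. `-log ρ : ℝⁿ → (-∞, ∞]` is convex. -/
def IsLogConcaveFun {n : ℕ} (ρ : EuclideanSpace ℝ (Fin n) → ℝ) : Prop :=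
  (∀ x, 0 ≤ ρ x) ∧
    ∀ x y : EuclideanSpace ℝ (Fin n), ∀ a b : ℝ, 0 < a → 0 < b → a + b = 1 →
      ρ x ^ a * ρ y ^ b ≤ ρ (a • x + b • y)

/-- A measure on `ℝⁿ` is log-concave if it has a log-concave density
with respect to Lebesgue measure. -/
def IsLogConcave {n : ℕ} (μ : Measure (EuclideanSpace ℝ (Fin n))) : Prop :=
  ∃ ρ : EuclideanSpace ℝ (Fin n) → ℝ, Measurable ρ ∧ IsLogConcaveFun ρ ∧
    μ = volume.withDensity (fun x => ENNReal.ofReal (ρ x))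

/-- The barycenter of a probability measure on `ℝⁿ` exists and is the origin. -/
def IsCentered {n : ℕ} (μ : Measure (EuclideanSpace ℝ (Fin n))) : Prop :=
  Integrable (fun x => x) μ ∧ ∫ x, x ∂μ = 0

/-- The logarithmic Laplace transform `Λ_μ(ξ) = log ∫ exp ⟨ξ, x⟩ dμ(x)`,
which may take the value `∞`. -/
def logLaplace {n : ℕ} (μ : Measure (EuclideanSpace ℝ (Fin n)))
    (ξ : EuclideanSpace ℝ (Fin n)) : EReal :=
  ENNReal.log (∫⁻ x, ENNReal.ofReal (Real.exp (inner ℝ ξ x)) ∂μ)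

/-- The body `Λ_p(μ) = {Λ_μ ≤ p} ∩ -{Λ_μ ≤ p}`. -/
def lambdaBody {n : ℕ} (p : ℝ) (μ : Measure (EuclideanSpace ℝ (Fin n))) :
    Set (EuclideanSpace ℝ (Fin n)) :=
  {ξ | logLaplace μ ξ ≤ (p : EReal)} ∩ -{ξ | logLaplace μ ξ ≤ (p : EReal)}

/-- The function `h_{Z_p(μ)}(θ) = (∫ |⟨x, θ⟩|^p dμ(x))^{1/p}`. -/
def centroidSupport {n : ℕ} (p : ℝ) (μ : Measure (EuclideanSpace ℝ (Fin n)))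
    (θ : EuclideanSpace ℝ (Fin n)) : ℝ :=
  (∫ x, |inner ℝ x θ| ^ p ∂μ) ^ (1 / p)

/-- The `L_p`-centroid body `Z_p(μ)`: the closed convex set whose supporting functional is
`h_{Z_p(μ)}`. -/
def centroidBody {n : ℕ} (p : ℝ) (μ : Measure (EuclideanSpace ℝ (Fin n))) :
    Set (EuclideanSpace ℝ (Fin n)) :=
  {y | ∀ θ : EuclideanSpace ℝ (Fin n), inner ℝ y θ ≤ centroidSupport p μ θ}

/-- The measure with density proportional to `exp ⟨ξ, x⟩` with respect to `μ`, before
recentering. If `μ` has density `ρ`, its density is `ρ(x) exp ⟨ξ, x⟩ / Z_ξ`. -/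
def expTilt {n : ℕ} (μ : Measure (EuclideanSpace ℝ (Fin n)))
    (ξ : EuclideanSpace ℝ (Fin n)) : Measure (EuclideanSpace ℝ (Fin n)) :=
  μ.tilted (fun x => inner ℝ ξ x)

/-- The barycenter `b_ξ` of the exponentially tilted measure. -/
def tiltBarycenter {n : ℕ} (μ : Measure (EuclideanSpace ℝ (Fin n)))
    (ξ : EuclideanSpace ℝ (Fin n)) : EuclideanSpace ℝ (Fin n) :=
  ∫ x, x ∂(expTilt μ ξ)

/-- The tilt `μ_ξ`: the exponentially tilted measure, translated so that its barycenter
is the origin. -/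
def tilt {n : ℕ} (μ : Measure (EuclideanSpace ℝ (Fin n)))
    (ξ : EuclideanSpace ℝ (Fin n)) : Measure (EuclideanSpace ℝ (Fin n)) :=
  (expTilt μ ξ).map (fun x => x - tiltBarycenter μ ξ)

/-- `c K ⊆ T ⊆ C K`. -/
def IsoWith {n : ℕ} (c C : ℝ) (K T : Set (EuclideanSpace ℝ (Fin n))) : Prop :=
  c • K ⊆ T ∧ T ⊆ C • K

end LogConcaveTilt

end

namespace LogConcaveTilt

open MeasureTheory Set
open scoped ENNReal

/-! Write `Λ` for the log-Laplace transform of `μ`. With `b` the barycenter of the uncentered tilt,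
the transform of `μ_x` at `z` is `Λ(x+z) - Λ(x) - ⟨z,b⟩`. Everything about the first claim follows
from three properties: `Λ` is midpoint convex, `Λ(0) ≤ 0`, and the transform of a centered measure
is nonnegative (Jensen). The only unknown is the linear term `⟨z,b⟩`. Bounds at both `z` and `-z`
carry it with opposite signs, so nonnegativity at one of these points bounds the term at the other.
This gives both inclusions with factor 4 (`lambdaBody_subset_tilt`, `lambdaBody_tilt_subset`).

The second claim is reduced to the first: up to universal constants, `Λ_p` is `p` times the polar of
`Z_p`. A point of `Λ_p` has `h_{Z_p} ≤ 6p`, from `t^p ≤ p^p e^t`. Conversely, a bound on the `p`-th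
moment of a linear functional gives an exponential moment. This direction needs log-concavity:
Markov's inequality makes the tail small at one level, and Borell's lemma makes it decay
exponentially from there on.

Borell's lemma rests on the multiplicative Brunn–Minkowski inequality for `μ`, a consequence of
Prékopa–Leindler, which is proved by induction on the dimension. Log-concavity also enters the first
claim, but only to give the tilt a barycenter. -/

/-! ### The Prékopa–Leindler inequality -/

/-- The one-dimensional Brunn–Minkowski inequality for compact sets. -/
theorem volume_add_le_of_isCompact {A B : Set ℝ} (hA : IsCompact A) (hB : IsCompact B)
    (hA0 : A.Nonempty) (hB0 : B.Nonempty) : volume A + volume B ≤ volume (A + B) := by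
  obtain ⟨α, hαA, hα⟩ := hA.exists_isGreatest hA0
  obtain ⟨β, hβB, hβ⟩ := hB.exists_isLeast hB0
  have h1 : (fun x => x + β) '' A ⊆ A + B := by
    rintro _ ⟨x, hx, rfl⟩
    exact add_mem_add hx hβB
  have h2 : (fun x => α + x) '' B ⊆ A + B := by
    rintro _ ⟨x, hx, rfl⟩
    exact add_mem_add hαA hx
  have hv1 : volume ((fun x => x + β) '' A) = volume A := by simp
  have hv2 : volume ((fun x => α + x) '' B) = volume B := by simp
  -- The translate of `A` lies to the left of `α + β` and the translate of `B` to the right, so they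
  -- meet at most there.
  have hd : AEDisjoint volume ((fun x => x + β) '' A) ((fun x => α + x) '' B) := by
    refine measure_mono_null (t := {α + β}) ?_ (by simp)
    rintro _ ⟨⟨x, hx, rfl⟩, ⟨y, hy, hxy⟩⟩
    have := hα hx
    have := hβ hy
    simp only [mem_singleton_iff] at *
    linarith
  rw [← hv1, ← hv2, ← measure_union₀ _ hd]
  · exact measure_mono (union_subset h1 h2)
  · exact ((hB.image (continuous_const.add continuous_id)).measurableSet).nullMeasurableSet

/-- The one-dimensional Brunn–Minkowski inequality for convex combinations. -/
theorem volume_convex_comb_le {A B C : Set ℝ} {a b : ℝ} (ha : 0 < a) (hb : 0 < b)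
    (hA : MeasurableSet A) (hB : MeasurableSet B) (hA0 : A.Nonempty) (hB0 : B.Nonempty)
    (h : ∀ x ∈ A, ∀ y ∈ B, a * x + b * y ∈ C) :
    ENNReal.ofReal a * volume A + ENNReal.ofReal b * volume B ≤ volume C := by
  have key : ∀ K ⊆ A, IsCompact K → ∀ L ⊆ B, IsCompact L →
      ENNReal.ofReal a * volume K + ENNReal.ofReal b * volume L ≤ volume C := by
    have main : ∀ K ⊆ A, IsCompact K → K.Nonempty → ∀ L ⊆ B, IsCompact L → L.Nonempty →
        ENNReal.ofReal a * volume K + ENNReal.ofReal b * volume L ≤ volume C := by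
      intro K hKA hK hK0 L hLB hL hL0
      have h1 := volume_add_le_of_isCompact (hK.smul a) (hL.smul b) hK0.smul_set hL0.smul_set
      rw [Measure.addHaar_smul, Measure.addHaar_smul] at h1
      simp only [Module.finrank_self, pow_one, abs_of_pos ha, abs_of_pos hb] at h1
      refine h1.trans (measure_mono ?_)
      rintro _ ⟨_, ⟨x, hx, rfl⟩, _, ⟨y, hy, rfl⟩, rfl⟩
      exact h x (hKA hx) y (hLB hy)
    intro K hKA hK L hLB hL
    obtain ⟨x, hx⟩ := hA0
    obtain ⟨y, hy⟩ := hB0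
    -- An approximating compact set may be empty, and Brunn–Minkowski fails for empty sets;
    -- adjoining one point repairs this.
    refine le_trans ?_ (main (insert x K) (insert_subset hx hKA) (hK.insert x) (by simp)
      (insert y L) (insert_subset hy hLB) (hL.insert y) (by simp))
    gcongr <;> exact subset_insert _ _
  have hsup : ∀ {D : Set ℝ}, MeasurableSet D →
      volume D = ⨆ K : {K : Set ℝ // K ⊆ D ∧ IsCompact K}, volume (K : Set ℝ) := by
    intro D hD
    rw [hD.measure_eq_iSup_isCompact, iSup_subtype]
    simp only [iSup_and]
  have hne : ∀ D : Set ℝ, Nonempty {K : Set ℝ // K ⊆ D ∧ IsCompact K} := fun D =>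
    ⟨⟨∅, by simp⟩⟩
  have := hne A
  have := hne B
  rw [hsup hA, hsup hB, ENNReal.mul_iSup, ENNReal.mul_iSup, ENNReal.iSup_add]
  refine iSup_le fun K => ?_
  rw [ENNReal.add_iSup]
  exact iSup_le fun L => key K K.2.1 K.2.2 L L.2.1 L.2.2

theorem lintegral_eq_lintegral_meas_lt_of_le_one {f : ℝ → ℝ≥0∞} (hf : Measurable f)
    (hf1 : ∀ x, f x ≤ 1) :
    ∫⁻ x, f x = ∫⁻ t in Ioo (0 : ℝ) 1, volume {x | ENNReal.ofReal t < f x} := by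
  have h := lintegral_eq_lintegral_meas_lt (μ := (volume : Measure ℝ)) (f := fun x => (f x).toReal)
    (Filter.Eventually.of_forall fun x => ENNReal.toReal_nonneg) hf.ennreal_toReal.aemeasurable
  have hfin : ∀ x, f x ≠ ⊤ := fun x => ((hf1 x).trans_lt ENNReal.one_lt_top).ne
  simp only [ENNReal.ofReal_toReal (hfin _)] at h
  rw [h, ← Ioo_union_Ici_eq_Ioi (zero_lt_one' ℝ), lintegral_union measurableSet_Ici
    (by rw [Set.disjoint_left]; intro x hx hx'; exact absurd hx.2 (not_lt.2 hx'))]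
  have h0 : ∫⁻ t in Ici (1 : ℝ), volume {x | t < (f x).toReal} = 0 := by
    rw [setLIntegral_congr_fun measurableSet_Ici (g := fun _ => 0)]
    · simp
    · intro t ht
      have : {x | t < (f x).toReal} = ∅ := by
        ext x
        simp only [mem_ofPred_eq, mem_empty_iff_false, iff_false, not_lt]
        exact (ENNReal.toReal_mono ENNReal.one_ne_top (hf1 x)).trans (by simpa using ht)
      simp [this]
  rw [h0, add_zero]
  refine setLIntegral_congr_fun measurableSet_Ioo fun t ht => ?_
  congr 1
  ext x
  exact (ENNReal.ofReal_lt_iff_lt_toReal ht.1.le (hfin x)).symm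

theorem antitone_measure_superlevel (f : ℝ → ℝ≥0∞) :
    Antitone fun t : ℝ => volume {x | ENNReal.ofReal t < f x} := fun _ _ hst =>
  measure_mono fun _ hx => lt_of_le_of_lt (ENNReal.ofReal_le_ofReal hst) hx

/-- The additive form of the one-dimensional Prékopa–Leindler inequality, for functions
with supremum `1`. -/
theorem lintegral_convex_comb_le_of_iSup_eq_one {f g h : ℝ → ℝ≥0∞} {a b : ℝ}
    (ha : 0 < a) (hb : 0 < b) (hab : a + b = 1)
    (hf : Measurable f) (hg : Measurable g) (hh : Measurable h)
    (hf1 : ⨆ x, f x = 1) (hg1 : ⨆ x, g x = 1)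
    (H : ∀ x y, f x ^ a * g y ^ b ≤ h (a * x + b * y)) :
    ENNReal.ofReal a * (∫⁻ x, f x) + ENNReal.ofReal b * (∫⁻ x, g x) ≤ ∫⁻ x, h x := by
  -- Only levels `t < 1` matter, so `h` may be cut at 1. At such levels the superlevel sets of `f`
  -- and `g` are nonempty because both suprema equal 1, and Brunn–Minkowski applies level by level.
  have hh' : ∫⁻ x, min (h x) 1 ≤ ∫⁻ x, h x := lintegral_mono fun x => min_le_left _ _
  refine le_trans ?_ hh'
  rw [lintegral_eq_lintegral_meas_lt_of_le_one hf fun x => hf1 ▸ le_iSup f x,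
    lintegral_eq_lintegral_meas_lt_of_le_one hg fun x => hg1 ▸ le_iSup g x,
    lintegral_eq_lintegral_meas_lt_of_le_one (hh.min measurable_const) fun x => min_le_right _ _,
    ← lintegral_const_mul _ (antitone_measure_superlevel f).measurable,
    ← lintegral_const_mul _ (antitone_measure_superlevel g).measurable,
    ← lintegral_add_left ((antitone_measure_superlevel f).measurable.const_mul _)]
  refine setLIntegral_mono' measurableSet_Ioo fun t ht => ?_
  have ht1 : ENNReal.ofReal t < 1 := by
    simpa using (ENNReal.ofReal_lt_ofReal_iff zero_lt_one).2 ht.2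
  have hex : ∀ {u : ℝ → ℝ≥0∞}, ⨆ x, u x = 1 → {x | ENNReal.ofReal t < u x}.Nonempty := by
    intro u hu
    obtain ⟨x, hx⟩ := lt_iSup_iff.1 (hu ▸ ht1)
    exact ⟨x, hx⟩
  refine volume_convex_comb_le ha hb (measurableSet_lt measurable_const hf)
    (measurableSet_lt measurable_const hg) (hex hf1) (hex hg1)
    fun x hx y hy => lt_min (lt_of_lt_of_le ?_ (H x y)) ht1
  have : ENNReal.ofReal t = ENNReal.ofReal t ^ a * ENNReal.ofReal t ^ b := by
    rw [← ENNReal.rpow_add_of_nonneg _ _ ha.le hb.le, hab, ENNReal.rpow_one]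
  rw [this]
  exact ENNReal.mul_lt_mul (ENNReal.rpow_lt_rpow hx ha) (ENNReal.rpow_lt_rpow hy hb)

theorem geom_mean_le_arith_mean_ennreal {a b : ℝ} (ha : 0 < a) (hb : 0 < b) (hab : a + b = 1)
    (u v : ℝ≥0∞) : u ^ a * v ^ b ≤ ENNReal.ofReal a * u + ENNReal.ofReal b * v := by
  have hp : (a⁻¹).HolderConjugate b⁻¹ :=
    Real.holderConjugate_iff.2 ⟨(one_lt_inv₀ ha).2 (by linarith), by simpa using hab⟩
  have := ENNReal.young_inequality (u ^ a) (v ^ b) hp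
  rw [← ENNReal.rpow_mul, ← ENNReal.rpow_mul, mul_inv_cancel₀ ha.ne', mul_inv_cancel₀ hb.ne',
    ENNReal.rpow_one, ENNReal.rpow_one, ENNReal.ofReal_inv_of_pos ha, ENNReal.ofReal_inv_of_pos hb,
    div_eq_mul_inv, div_eq_mul_inv, inv_inv, inv_inv] at this
  rwa [mul_comm _ u, mul_comm _ v]

/-- Both sides scale alike under `f/S`, `g/T`, `h/(S^a T^b)`, so the suprema can be normalised to 1.
The additive form is then stronger than the product form, by the weighted AM–GM inequality. -/
theorem prekopa_leindler_real_of_iSup_lt_top {f g h : ℝ → ℝ≥0∞} {a b : ℝ}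
    (ha : 0 < a) (hb : 0 < b) (hab : a + b = 1)
    (hf : Measurable f) (hg : Measurable g) (hh : Measurable h)
    (hf1 : ⨆ x, f x ≠ ⊤) (hg1 : ⨆ x, g x ≠ ⊤)
    (H : ∀ x y, f x ^ a * g y ^ b ≤ h (a * x + b * y)) :
    (∫⁻ x, f x) ^ a * (∫⁻ x, g x) ^ b ≤ ∫⁻ x, h x := by
  set S := ⨆ x, f x with hS
  set T := ⨆ x, g x with hT
  rcases eq_or_ne S 0 with hS0 | hS0
  · have : ∀ x, f x = 0 := by simpa [hS, ENNReal.iSup_eq_zero] using hS0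
    simp [this, ha]
  rcases eq_or_ne T 0 with hT0 | hT0
  · have : ∀ x, g x = 0 := by simpa [hT, ENNReal.iSup_eq_zero] using hT0
    simp [this, hb]
  have hSa0 : S ^ a ≠ 0 := by simp [hS0, hf1]
  have hSa1 : S ^ a ≠ ⊤ := ENNReal.rpow_ne_top_of_nonneg ha.le hf1
  have hTb0 : T ^ b ≠ 0 := by simp [hT0, hg1]
  have hTb1 : T ^ b ≠ ⊤ := ENNReal.rpow_ne_top_of_nonneg hb.le hg1
  have key := lintegral_convex_comb_le_of_iSup_eq_one (f := fun x => S⁻¹ * f x)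
    (g := fun x => T⁻¹ * g x) (h := fun x => ((S ^ a)⁻¹ * (T ^ b)⁻¹) * h x) ha hb hab
    (hf.const_mul _) (hg.const_mul _) (hh.const_mul _)
    (by rw [← ENNReal.mul_iSup, ENNReal.inv_mul_cancel hS0 hf1])
    (by rw [← ENNReal.mul_iSup, ENNReal.inv_mul_cancel hT0 hg1])
    (fun x y => by
      rw [ENNReal.mul_rpow_of_nonneg _ _ ha.le, ENNReal.mul_rpow_of_nonneg _ _ hb.le,
        ENNReal.inv_rpow, ENNReal.inv_rpow, mul_mul_mul_comm]
      gcongr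
      exact H x y)
  have key2 := (geom_mean_le_arith_mean_ennreal ha hb hab _ _).trans key
  rw [lintegral_const_mul _ hf, lintegral_const_mul _ hg, lintegral_const_mul _ hh,
    ENNReal.mul_rpow_of_nonneg _ _ ha.le, ENNReal.mul_rpow_of_nonneg _ _ hb.le,
    ENNReal.inv_rpow, ENNReal.inv_rpow, mul_mul_mul_comm] at key2
  refine (ENNReal.mul_le_mul_iff_right ?_ ?_).1 key2
  · simp [hSa1, hTb1]
  · simp [ENNReal.mul_eq_top, hSa0, hTb0]

/-- Truncating `f` and `g` at integer heights preserves the hypothesis, and monotone convergence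
removes the truncation. -/
theorem prekopa_leindler_real {f g h : ℝ → ℝ≥0∞} {a b : ℝ}
    (ha : 0 < a) (hb : 0 < b) (hab : a + b = 1)
    (hf : Measurable f) (hg : Measurable g) (hh : Measurable h)
    (H : ∀ x y, f x ^ a * g y ^ b ≤ h (a * x + b * y)) :
    (∫⁻ x, f x) ^ a * (∫⁻ x, g x) ^ b ≤ ∫⁻ x, h x := by
  have trunc : ∀ {f : ℝ → ℝ≥0∞}, Measurable f →
      ∫⁻ x, f x = ⨆ N : ℕ, ∫⁻ x, min (f x) N := by
    intro f hf
    rw [← lintegral_iSup (fun N => hf.min measurable_const)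
      (fun i j hij x => min_le_min le_rfl (by exact_mod_cast hij))]
    refine lintegral_congr fun x => ?_
    rw [← inf_iSup_eq, ENNReal.iSup_natCast, inf_top_eq]
  have hrp : ∀ {c : ℝ}, 0 < c → ∀ u : ℕ → ℝ≥0∞, (⨆ N, u N) ^ c = ⨆ N, u N ^ c := fun hc u =>
    (ENNReal.orderIsoRpow _ hc).map_iSup u
  rw [trunc hf, trunc hg, hrp ha, hrp hb]
  simp only [ENNReal.iSup_mul, ENNReal.mul_iSup]
  refine iSup_le fun M => iSup_le fun N => ?_
  refine prekopa_leindler_real_of_iSup_lt_top ha hb hab (hf.min measurable_const)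
    (hg.min measurable_const) hh ?_ ?_ fun x y => le_trans ?_ (H x y)
  · exact ((iSup_le fun x => min_le_right _ _).trans_lt (ENNReal.natCast_lt_top _)).ne
  · exact ((iSup_le fun x => min_le_right _ _).trans_lt (ENNReal.natCast_lt_top _)).ne
  · gcongr <;> exact min_le_left _ _

theorem lintegral_pi_succ {n : ℕ} {f : (Fin (n + 1) → ℝ) → ℝ≥0∞} (hf : Measurable f) :
    ∫⁻ x, f x = ∫⁻ s : ℝ, ∫⁻ v : Fin n → ℝ, f (Fin.cons s v) := by
  have e := volume_preserving_piFinSuccAbove (fun _ : Fin (n + 1) => ℝ) 0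
  rw [← e.symm.lintegral_comp hf, Measure.volume_eq_prod,
    lintegral_prod (fun q : ℝ × (Fin n → ℝ) =>
      f ((MeasurableEquiv.piFinSuccAbove (fun _ : Fin (n + 1) => ℝ) 0).symm q))
      (hf.comp (MeasurableEquiv.measurable _)).aemeasurable]
  simp [Fin.insertNthEquiv]

theorem measurable_cons {n : ℕ} :
    Measurable fun q : ℝ × (Fin n → ℝ) => (Fin.cons q.1 q.2 : Fin (n + 1) → ℝ) :=
  measurable_pi_lambda _ fun i => by
    refine Fin.cases ?_ (fun j => ?_) i
    · simpa using measurable_fst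
    · simpa [Function.comp_def] using (measurable_pi_apply j).comp measurable_snd

/-- The **Prékopa–Leindler inequality**. -/
theorem prekopa_leindler {a b : ℝ} (ha : 0 < a) (hb : 0 < b) (hab : a + b = 1) :
    ∀ {n : ℕ} {f g h : (Fin n → ℝ) → ℝ≥0∞}, Measurable f → Measurable g → Measurable h →
    (∀ x y, f x ^ a * g y ^ b ≤ h (a • x + b • y)) →
    (∫⁻ x, f x) ^ a * (∫⁻ x, g x) ^ b ≤ ∫⁻ x, h x
  | 0, f, g, h, hf, hg, hh, H => by
    simp only [volume_pi, Measure.pi_of_empty (fun _ : Fin 0 => (volume : Measure ℝ)) default,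
      lintegral_dirac]
    refine (H _ _).trans_eq ?_
    congr 1
    exact Subsingleton.elim _ _
  | n + 1, f, g, h, hf, hg, hh, H => by
    have hm : ∀ {f : (Fin (n + 1) → ℝ) → ℝ≥0∞}, Measurable f →
        Measurable fun s : ℝ => ∫⁻ v : Fin n → ℝ, f (Fin.cons s v) := fun hf =>
      (hf.comp measurable_cons).lintegral_prod_right'
    have hc : ∀ s : ℝ, Measurable fun v : Fin n → ℝ => (Fin.cons s v : Fin (n + 1) → ℝ) :=
      fun s => measurable_cons.comp measurable_prodMk_left
    rw [lintegral_pi_succ hf, lintegral_pi_succ hg, lintegral_pi_succ hh]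
    -- The marginals in the first coordinate satisfy the one-dimensional hypothesis, by the
    -- inequality on the fibres in one dimension less.
    refine prekopa_leindler_real ha hb hab (hm hf) (hm hg) (hm hh) fun s t => ?_
    refine prekopa_leindler ha hb hab (hf.comp (hc _)) (hg.comp (hc _)) (hh.comp (hc _))
      fun v w => ?_
    have : (Fin.cons (a * s + b * t) (a • v + b • w) : Fin (n + 1) → ℝ) =
        a • (Fin.cons s v : Fin (n + 1) → ℝ) + b • (Fin.cons t w : Fin (n + 1) → ℝ) := by
      ext i
      refine Fin.cases ?_ (fun j => ?_) i <;> simp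
    simp only [this]
    exact H _ _

/-- A log-concave measure satisfies the multiplicative Brunn–Minkowski inequality. -/
theorem IsLogConcave.measure_rpow_mul_le {n : ℕ} {μ : Measure (EuclideanSpace ℝ (Fin n))}
    (hμ : IsLogConcave μ) {a b : ℝ} (ha : 0 < a) (hb : 0 < b) (hab : a + b = 1)
    {A B C : Set (EuclideanSpace ℝ (Fin n))} (hA : MeasurableSet A) (hB : MeasurableSet B)
    (hC : MeasurableSet C) (h : ∀ x ∈ A, ∀ y ∈ B, a • x + b • y ∈ C) :
    μ A ^ a * μ B ^ b ≤ μ C := by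
  obtain ⟨ρ, hρm, ⟨hρ0, hρ⟩, rfl⟩ := hμ
  have hr : Measurable fun x => ENNReal.ofReal (ρ x) := hρm.ennreal_ofReal
  have hint : ∀ {D : Set (EuclideanSpace ℝ (Fin n))}, MeasurableSet D →
      (volume.withDensity fun x => ENNReal.ofReal (ρ x)) D =
        ∫⁻ x : Fin n → ℝ, D.indicator (fun x => ENNReal.ofReal (ρ x)) (WithLp.toLp 2 x) := by
    intro D hD
    rw [withDensity_apply _ hD, ← lintegral_indicator hD,
      (PiLp.volume_preserving_toLp (Fin n)).lintegral_comp (hr.indicator hD)]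
  have hm : Measurable (WithLp.toLp 2 : (Fin n → ℝ) → EuclideanSpace ℝ (Fin n)) :=
    (PiLp.volume_preserving_toLp (Fin n)).measurable
  rw [hint hA, hint hB, hint hC]
  refine prekopa_leindler ha hb hab ((hr.indicator hA).comp hm) ((hr.indicator hB).comp hm)
    ((hr.indicator hC).comp hm) fun x y => ?_
  simp only [WithLp.toLp_add, WithLp.toLp_smul]
  by_cases hx : WithLp.toLp 2 x ∈ A
  · by_cases hy : WithLp.toLp 2 y ∈ B
    · rw [indicator_of_mem hx, indicator_of_mem hy, indicator_of_mem (h _ hx _ hy),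
        ENNReal.ofReal_rpow_of_nonneg (hρ0 _) ha.le, ENNReal.ofReal_rpow_of_nonneg (hρ0 _) hb.le,
        ← ENNReal.ofReal_mul (Real.rpow_nonneg (hρ0 _) _)]
      exact ENNReal.ofReal_le_ofReal (hρ _ _ a b ha hb hab)
    · simp [indicator_of_notMem hy, hb]
  · simp [indicator_of_notMem hx, ha]

/-! ### Exponential moments of linear functionals -/

/-- This is `u ≤ e^u` at `u = x / p`, raised to the power `p`. -/
theorem rpow_le_rpow_mul_exp {x p : ℝ} (hx : 0 ≤ x) (hp : 0 < p) :
    x ^ p ≤ p ^ p * Real.exp x := by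
  have h1 : x / p ≤ Real.exp (x / p) := by linarith [Real.add_one_le_exp (x / p)]
  have h2 := Real.rpow_le_rpow (by positivity) h1 hp.le
  rw [Real.div_rpow hx hp.le, ← Real.exp_mul, div_mul_cancel₀ _ hp.ne',
    div_le_iff₀ (Real.rpow_pos_of_pos hp _)] at h2
  linarith

theorem integrable_of_lintegral_ofReal_le {n : ℕ} {μ : Measure (EuclideanSpace ℝ (Fin n))}
    {f : EuclideanSpace ℝ (Fin n) → ℝ} (hf : Measurable f) (hf0 : ∀ y, 0 ≤ f y) {M : ℝ}
    (h : ∫⁻ y, ENNReal.ofReal (f y) ∂μ ≤ ENNReal.ofReal M) :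
    Integrable f μ :=
  ⟨hf.aestronglyMeasurable, (hasFiniteIntegral_iff_ofReal (.of_forall hf0)).2
    (h.trans_lt ENNReal.ofReal_lt_top)⟩

section ExponentialMoments

variable {n : ℕ} {μ : Measure (EuclideanSpace ℝ (Fin n))} [IsProbabilityMeasure μ]

/-- Borell's lemma for half-spaces. -/
theorem IsLogConcave.measureReal_halfspace_le (hμ : IsLogConcave μ)
    (θ : EuclideanSpace ℝ (Fin n)) {p s t : ℝ} (hp : 1 ≤ p) (hs : 0 < s)
    (h : μ.real {y | s ≤ |inner ℝ θ y|} ≤ Real.exp (-(3 * p))) (ht : 1 ≤ t) :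
    μ.real {y | t * s ≤ inner ℝ θ y} ≤ Real.exp (-(p * (t + 1))) := by
  have hl : Measurable fun y : EuclideanSpace ℝ (Fin n) => inner ℝ θ y := by fun_prop
  have hS : ∀ u : ℝ, MeasurableSet {y : EuclideanSpace ℝ (Fin n) | u ≤ inner ℝ θ y} := fun u =>
    measurableSet_le measurable_const hl
  have hup : μ.real {y | s ≤ inner ℝ θ y} ≤ Real.exp (-(3 * p)) :=
    (measureReal_mono fun y (hy : s ≤ inner ℝ θ y) => hy.trans (le_abs_self _)).trans h
  rcases ht.eq_or_lt with rfl | ht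
  · rw [one_mul]
    refine hup.trans (Real.exp_le_exp.2 (by linarith))
  have hlow : Real.exp (-p) ≤ μ.real {y | -s ≤ inner ℝ θ y} := by
    have hc : {y : EuclideanSpace ℝ (Fin n) | -s ≤ inner ℝ θ y}ᶜ ⊆ {y | s ≤ |inner ℝ θ y|} := by
      intro y hy
      have hy' : inner ℝ θ y < -s := not_le.1 hy
      exact (by linarith : s ≤ -inner ℝ θ y).trans (neg_le_abs _)
    have h1 := (measureReal_mono hc).trans h
    rw [probReal_compl_eq_one_sub (hS _)] at h1
    have e1 : Real.exp (-p) ≤ 1 / 2 := by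
      have h2 : (2 : ℝ) ≤ Real.exp p := by linarith [Real.add_one_le_exp p]
      rw [Real.exp_neg, one_div]
      exact inv_anti₀ two_pos h2
    have e2 : Real.exp (-(3 * p)) ≤ Real.exp (-p) := Real.exp_le_exp.2 (by linarith)
    linarith
  -- The weight is chosen so that the levels `-s` and `t * s` combine to exactly `s`. At `t = 1` the
  -- other weight would vanish, hence the separate case above.
  have hb : 0 < 2 / (t + 1) := by positivity
  have ha : 0 < 1 - 2 / (t + 1) := by
    rw [sub_pos, div_lt_one (by linarith)]; linarith
  have hBM := hμ.measure_rpow_mul_le ha hb (by ring) (hS (-s)) (hS (t * s)) (hS s)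
    (fun y (hy : -s ≤ inner ℝ θ y) z (hz : t * s ≤ inner ℝ θ z) => by
      change s ≤ inner ℝ θ _
      rw [inner_add_right, inner_smul_right, inner_smul_right]
      have h1 := mul_le_mul_of_nonneg_left hy ha.le
      have h2 := mul_le_mul_of_nonneg_left hz hb.le
      have h3 : (1 - 2 / (t + 1)) * -s + 2 / (t + 1) * (t * s) = s := by
        field_simp; ring
      linarith)
  have hBM' := ENNReal.toReal_mono (measure_ne_top _ _) hBM
  rw [ENNReal.toReal_mul, ← ENNReal.toReal_rpow, ← ENNReal.toReal_rpow] at hBM'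
  change μ.real _ ^ _ * μ.real _ ^ _ ≤ μ.real _ at hBM'
  have h1 : Real.exp (-p) ≤ μ.real {y | -s ≤ inner ℝ θ y} ^ (1 - 2 / (t + 1)) := by
    calc Real.exp (-p) ≤ Real.exp (-p * (1 - 2 / (t + 1))) := Real.exp_le_exp.2 (by nlinarith)
      _ = Real.exp (-p) ^ (1 - 2 / (t + 1)) := Real.exp_mul _ _
      _ ≤ _ := Real.rpow_le_rpow (Real.exp_pos _).le hlow ha.le
  have h2 : μ.real {y | t * s ≤ inner ℝ θ y} ^ (2 / (t + 1)) ≤ Real.exp (-(2 * p)) := by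
    have h3 : Real.exp (-p) * μ.real {y | t * s ≤ inner ℝ θ y} ^ (2 / (t + 1)) ≤
        Real.exp (-p) * Real.exp (-(2 * p)) := by
      rw [← Real.exp_add]
      refine (mul_le_mul_of_nonneg_right h1 (Real.rpow_nonneg measureReal_nonneg _)).trans
        (hBM'.trans (hup.trans_eq ?_))
      ring_nf
    exact le_of_mul_le_mul_left h3 (Real.exp_pos _)
  have h4 := Real.rpow_le_rpow (Real.rpow_nonneg measureReal_nonneg _) h2
    (by positivity : 0 ≤ (t + 1) / 2)
  rw [← Real.rpow_mul measureReal_nonneg, ← Real.exp_mul,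
    show 2 / (t + 1) * ((t + 1) / 2) = 1 by field_simp, Real.rpow_one] at h4
  refine h4.trans_eq ?_
  ring_nf

theorem IsLogConcave.measure_slab_compl_le (hμ : IsLogConcave μ)
    (θ : EuclideanSpace ℝ (Fin n)) {p s t : ℝ} (hp : 1 ≤ p) (hs : 0 < s)
    (h : μ.real {y | s ≤ |inner ℝ θ y|} ≤ Real.exp (-(3 * p))) (ht : 1 ≤ t) :
    μ {y | t * s ≤ |inner ℝ θ y|} ≤ ENNReal.ofReal (2 * Real.exp (-(p * (t + 1)))) := by
  have h1 := hμ.measureReal_halfspace_le θ hp hs h ht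
  have h2 := hμ.measureReal_halfspace_le (-θ) hp hs (by simpa using h) ht
  rw [← ENNReal.ofReal_toReal (measure_ne_top μ _)]
  refine ENNReal.ofReal_le_ofReal ?_
  have hsub : {y : EuclideanSpace ℝ (Fin n) | t * s ≤ |inner ℝ θ y|} ⊆
      {y | t * s ≤ inner ℝ θ y} ∪ {y | t * s ≤ inner ℝ (-θ) y} := by
    intro y (hy : t * s ≤ |inner ℝ θ y|)
    rcases le_abs.1 hy with h | h
    · exact Or.inl h
    · exact Or.inr (by simpa using h)
  have := (measureReal_mono hsub).trans (measureReal_union_le (μ := μ) _ _)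
  change μ.real _ ≤ _
  linarith

/-- Exponential integrability of a linear functional whose tail is small at one level. -/
theorem IsLogConcave.lintegral_exp_le_of_tail (hμ : IsLogConcave μ)
    (θ : EuclideanSpace ℝ (Fin n)) {p s : ℝ} (hp : 1 ≤ p) (hs : 0 < s)
    (h : μ.real {y | s ≤ |inner ℝ θ y|} ≤ Real.exp (-(3 * p))) :
    ∫⁻ y, ENNReal.ofReal (Real.exp (p / (4 * s) * |inner ℝ θ y|)) ∂μ ≤
      ENNReal.ofReal (Real.exp p) := by
  set A : ℕ → Set (EuclideanSpace ℝ (Fin n)) := fun k => {y | ((k : ℝ) + 1) * s ≤ |inner ℝ θ y|}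
  have hA : ∀ k, MeasurableSet (A k) := fun k =>
    measurableSet_le measurable_const (by fun_prop)
  -- On the layer where `|⟨θ,y⟩| / s` lies in `[k+1, k+2)` the integrand is at most `w k`. Borell
  -- gives the layer mass at most `2 exp(-p(k+2))`, so its contribution is at most `2 q^(k+2)` with
  -- `q = exp(-3p/4) ≤ 1/2`, and the sum is at most 1.
  set w : ℕ → ℝ := fun k => Real.exp (p / 4 * (k + 2))
  have hpt : ∀ y : EuclideanSpace ℝ (Fin n),
      ENNReal.ofReal (Real.exp (p / (4 * s) * |inner ℝ θ y|)) ≤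
        ENNReal.ofReal (Real.exp (p / 4)) +
          ∑' k, (A k).indicator (fun _ => ENNReal.ofReal (w k)) y := by
    intro y
    set l := |inner ℝ θ y| with hl
    have hl0 : 0 ≤ l := abs_nonneg _
    rcases Nat.eq_zero_or_pos ⌊l / s⌋₊ with h0 | h0
    · refine le_add_right (ENNReal.ofReal_le_ofReal (Real.exp_le_exp.2 ?_))
      have h1 : l / s < 1 := Nat.floor_eq_zero.1 h0
      calc p / (4 * s) * l = p / 4 * (l / s) := by field_simp
        _ ≤ p / 4 * 1 := by gcongr
        _ = p / 4 := mul_one _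
    · obtain ⟨k, hk⟩ : ∃ k, ⌊l / s⌋₊ = k + 1 := ⟨_, (Nat.succ_pred_eq_of_pos h0).symm⟩
      refine le_add_left (le_trans ?_ (ENNReal.le_tsum k))
      have h1 : ((k + 1 : ℕ) : ℝ) ≤ l / s := hk ▸ Nat.floor_le (by positivity)
      have h2 : l / s < (k + 1 : ℕ) + 1 := hk ▸ Nat.lt_floor_add_one _
      push_cast at h1 h2
      rw [indicator_of_mem (show y ∈ A k from (le_div_iff₀ hs).1 h1)]
      refine ENNReal.ofReal_le_ofReal (Real.exp_le_exp.2 ?_)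
      calc p / (4 * s) * l = p / 4 * (l / s) := by field_simp
        _ ≤ p / 4 * (k + 2) := by gcongr; linarith
  set q := Real.exp (-(3 / 4 * p)) with hq
  have hq0 : 0 < q := Real.exp_pos _
  have hE : (2 : ℝ) ≤ Real.exp (3 / 4 * p) := by
    have h1 : (2 : ℝ) ≤ Real.exp (3 / 4) := by
      have := Real.quadratic_le_exp_of_nonneg (x := 3 / 4) (by norm_num)
      norm_num at this ⊢
      linarith
    exact h1.trans (Real.exp_le_exp.2 (by linarith))
  have hq2 : q ≤ 1 / 2 := by
    rw [hq, Real.exp_neg, one_div]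
    exact inv_anti₀ two_pos hE
  have hterm : ∀ k, ENNReal.ofReal (w k) * μ (A k) ≤ ENNReal.ofReal (2 * q ^ 2 * q ^ k) := by
    intro k
    have h1 := hμ.measure_slab_compl_le θ hp hs h (t := (k : ℝ) + 1) (by simp)
    refine (mul_le_mul_right h1 _).trans_eq ?_
    rw [← ENNReal.ofReal_mul (Real.exp_pos _).le, mul_left_comm, ← Real.exp_add, mul_assoc,
      ← pow_add, hq, ← Real.exp_nat_mul]
    congr 3
    push_cast
    ring
  calc ∫⁻ y, ENNReal.ofReal (Real.exp (p / (4 * s) * |inner ℝ θ y|)) ∂μ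
      ≤ ∫⁻ y, (ENNReal.ofReal (Real.exp (p / 4)) +
          ∑' k, (A k).indicator (fun _ => ENNReal.ofReal (w k)) y) ∂μ := lintegral_mono hpt
    _ = ENNReal.ofReal (Real.exp (p / 4)) + ∑' k, ENNReal.ofReal (w k) * μ (A k) := by
      rw [lintegral_add_left measurable_const, lintegral_const, measure_univ, mul_one,
        lintegral_tsum fun k => (measurable_const.indicator (hA k)).aemeasurable]
      simp_rw [lintegral_indicator_const (hA _)]
    _ ≤ ENNReal.ofReal (Real.exp (p / 4)) + ∑' k, ENNReal.ofReal (2 * q ^ 2 * q ^ k) := by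
      gcongr with k
      exact hterm k
    _ = ENNReal.ofReal (Real.exp (p / 4)) + ENNReal.ofReal (2 * q ^ 2 * (1 - q)⁻¹) := by
      have hg := summable_geometric_of_lt_one hq0.le (by linarith : q < 1)
      rw [← ENNReal.ofReal_tsum_of_nonneg (fun k => by positivity) (hg.mul_left _), tsum_mul_left,
        tsum_geometric_of_lt_one hq0.le (by linarith)]
    _ ≤ ENNReal.ofReal (Real.exp p) := by
      have h1 : 2 * q ^ 2 * (1 - q)⁻¹ ≤ 1 := by
        rw [← div_eq_mul_inv, div_le_one (by linarith)]
        nlinarith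
      rw [← ENNReal.ofReal_add (Real.exp_pos _).le
        (mul_nonneg (by positivity) (inv_nonneg.2 (by linarith)))]
      refine ENNReal.ofReal_le_ofReal ?_
      have h2 : Real.exp p = Real.exp (p / 4) * Real.exp (3 / 4 * p) := by
        rw [← Real.exp_add]; ring_nf
      have h3 : 1 ≤ Real.exp (p / 4) := Real.one_le_exp (by linarith)
      rw [h2]
      nlinarith

/-- A bound on the `p`-th moment of a linear functional yields an exponential moment. -/
theorem IsLogConcave.lintegral_exp_le_of_moment (hμ : IsLogConcave μ)
    (θ : EuclideanSpace ℝ (Fin n)) {p r : ℝ} (hp : 1 ≤ p) (hr : 0 < r)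
    (h : ∫⁻ y, ENNReal.ofReal (|inner ℝ θ y| ^ p) ∂μ ≤ ENNReal.ofReal (r ^ p)) :
    ∫⁻ y, ENNReal.ofReal (Real.exp (p / (4 * (Real.exp 3 * r)) * |inner ℝ θ y|)) ∂μ ≤
      ENNReal.ofReal (Real.exp p) := by
  have hs : 0 < Real.exp 3 * r := by positivity
  have hsp : 0 < (Real.exp 3 * r) ^ p := Real.rpow_pos_of_pos hs _
  -- Markov's inequality for the `p`-th power at level `e³ r` gives exactly the tail `e^(-3p)` that
  -- Borell's lemma requires.
  refine hμ.lintegral_exp_le_of_tail θ hp hs ?_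
  have h1 := (mul_meas_ge_le_lintegral (μ := μ)
    (f := fun y => ENNReal.ofReal (|inner ℝ θ y| ^ p)) (by fun_prop)
    (ENNReal.ofReal ((Real.exp 3 * r) ^ p))).trans h
  have hset : {y : EuclideanSpace ℝ (Fin n) | ENNReal.ofReal ((Real.exp 3 * r) ^ p) ≤
      ENNReal.ofReal (|inner ℝ θ y| ^ p)} = {y | Real.exp 3 * r ≤ |inner ℝ θ y|} := by
    ext y
    exact (ENNReal.ofReal_le_ofReal_iff (Real.rpow_nonneg (abs_nonneg _) _)).trans
      (Real.rpow_le_rpow_iff hs.le (abs_nonneg _) (by linarith))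
  rw [hset] at h1
  have h2 := ENNReal.toReal_mono ENNReal.ofReal_ne_top h1
  rw [ENNReal.toReal_mul, ENNReal.toReal_ofReal hsp.le,
    ENNReal.toReal_ofReal (Real.rpow_nonneg hr.le _),
    Real.mul_rpow (Real.exp_pos _).le hr.le, ← Real.exp_mul] at h2
  change _ * μ.real _ ≤ _ at h2
  have hrp : 0 < r ^ p := Real.rpow_pos_of_pos hr _
  rw [Real.exp_neg, ← one_div, le_div_iff₀ (Real.exp_pos _)]
  nlinarith

theorem IsLogConcave.exists_integrable_exp (hμ : IsLogConcave μ)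
    (hint : Integrable (fun y => y) μ) (θ : EuclideanSpace ℝ (Fin n)) :
    ∃ c : ℝ, 0 < c ∧ Integrable (fun y => Real.exp (c * |inner ℝ θ y|)) μ := by
  have hi : Integrable (fun y => |inner ℝ θ y|) μ := (hint.const_inner θ).abs
  have h0 : 0 ≤ ∫ y, |inner ℝ θ y| ∂μ := integral_nonneg fun y => abs_nonneg _
  have hr : 0 < ∫ y, |inner ℝ θ y| ∂μ + 1 := by linarith
  refine ⟨_, ?_, integrable_of_lintegral_ofReal_le (by fun_prop) (fun y => (Real.exp_pos _).le)
    (hμ.lintegral_exp_le_of_moment θ le_rfl hr ?_)⟩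
  · positivity
  · simp only [Real.rpow_one]
    rw [← ofReal_integral_eq_lintegral_ofReal hi (.of_forall fun y => abs_nonneg _)]
    exact ENNReal.ofReal_le_ofReal (by linarith)

theorem IsLogConcave.integrable_abs_rpow (hμ : IsLogConcave μ)
    (hint : Integrable (fun y => y) μ) (θ : EuclideanSpace ℝ (Fin n)) {p : ℝ} (hp : 0 < p) :
    Integrable (fun y => |inner ℝ θ y| ^ p) μ := by
  obtain ⟨c, hc, hi⟩ := hμ.exists_integrable_exp hint θ
  refine (hi.const_mul ((c ^ p)⁻¹ * p ^ p)).mono'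
    (Measurable.aestronglyMeasurable (by fun_prop)) (.of_forall fun y => ?_)
  have hcp : 0 < c ^ p := Real.rpow_pos_of_pos hc _
  rw [Real.norm_of_nonneg (Real.rpow_nonneg (abs_nonneg _) _), mul_assoc,
    ← div_eq_inv_mul, le_div_iff₀ hcp, mul_comm, ← Real.mul_rpow hc.le (abs_nonneg _)]
  exact rpow_le_rpow_mul_exp (by positivity) hp

theorem IsLogConcave.integrable_norm_sq (hμ : IsLogConcave μ)
    (hint : Integrable (fun y => y) μ) : Integrable (fun y => ‖y‖ ^ 2) μ := by
  have : ∀ i : Fin n, Integrable (fun y : EuclideanSpace ℝ (Fin n) => y i ^ 2) μ := by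
    intro i
    have := hμ.integrable_abs_rpow hint (EuclideanSpace.single i 1) two_pos
    simpa [EuclideanSpace.inner_single_left] using this
  simp_rw [EuclideanSpace.real_norm_sq_eq]
  exact integrable_finsetSum _ fun i _ => this i

end ExponentialMoments

/-! ### The logarithmic Laplace transform -/

section LogLaplace

variable {n : ℕ} {μ : Measure (EuclideanSpace ℝ (Fin n))}

theorem logLaplace_le_iff {ξ : EuclideanSpace ℝ (Fin n)} {u : ℝ} :
    logLaplace μ ξ ≤ (u : EReal) ↔
      ∫⁻ y, ENNReal.ofReal (Real.exp (inner ℝ ξ y)) ∂μ ≤ ENNReal.ofReal (Real.exp u) := by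
  have : (u : EReal) = ENNReal.log (ENNReal.ofReal (Real.exp u)) := by
    rw [ENNReal.log_ofReal_of_pos (Real.exp_pos _), Real.log_exp]
  rw [logLaplace, this, ENNReal.log_le_log_iff]

theorem integrable_exp_of_logLaplace_le {ξ : EuclideanSpace ℝ (Fin n)} {u : ℝ}
    (h : logLaplace μ ξ ≤ (u : EReal)) : Integrable (fun y => Real.exp (inner ℝ ξ y)) μ :=
  integrable_of_lintegral_ofReal_le (by fun_prop) (fun _ => (Real.exp_pos _).le)
    (logLaplace_le_iff.1 h)

/-- Midpoint convexity of the logarithmic Laplace transform. -/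
theorem logLaplace_midpoint_le {ξ η ζ : EuclideanSpace ℝ (Fin n)} {u v w : ℝ}
    (hξ : logLaplace μ ξ ≤ (u : EReal)) (hη : logLaplace μ η ≤ (v : EReal))
    (hζ : (2 : ℝ) • ζ = ξ + η) (hw : u + v ≤ 2 * w) : logLaplace μ ζ ≤ (w : EReal) := by
  rw [logLaplace_le_iff] at *
  -- AM–GM with weights balanced so that both terms integrate to at most `exp((u+v)/2) / 2`; this
  -- replaces Cauchy–Schwarz.
  have hpt : ∀ y : EuclideanSpace ℝ (Fin n), ENNReal.ofReal (Real.exp (inner ℝ ζ y)) ≤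
      ENNReal.ofReal (Real.exp ((v - u) / 2) / 2) * ENNReal.ofReal (Real.exp (inner ℝ ξ y)) +
      ENNReal.ofReal (Real.exp ((u - v) / 2) / 2) * ENNReal.ofReal (Real.exp (inner ℝ η y)) := by
    intro y
    rw [← ENNReal.ofReal_mul (by positivity), ← ENNReal.ofReal_mul (by positivity),
      ← ENNReal.ofReal_add (by positivity) (by positivity)]
    refine ENNReal.ofReal_le_ofReal ?_
    have h1 : inner ℝ ζ y = (inner ℝ ξ y + inner ℝ η y) / 2 := by
      rw [← inner_add_left, ← hζ, real_inner_smul_left]; ring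
    set a := Real.exp ((v - u) / 4 + inner ℝ ξ y / 2) with ha
    set b := Real.exp ((u - v) / 4 + inner ℝ η y / 2) with hb
    have e1 : Real.exp ((v - u) / 2) / 2 * Real.exp (inner ℝ ξ y) = a ^ 2 / 2 := by
      rw [ha, ← Real.exp_nat_mul, div_mul_eq_mul_div, ← Real.exp_add]; push_cast; ring_nf
    have e2 : Real.exp ((u - v) / 2) / 2 * Real.exp (inner ℝ η y) = b ^ 2 / 2 := by
      rw [hb, ← Real.exp_nat_mul, div_mul_eq_mul_div, ← Real.exp_add]; push_cast; ring_nf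
    have e3 : Real.exp (inner ℝ ζ y) = a * b := by
      rw [ha, hb, ← Real.exp_add, h1]; ring_nf
    rw [e1, e2, e3]
    nlinarith [sq_nonneg (a - b)]
  refine (lintegral_mono hpt).trans ?_
  rw [lintegral_add_left (by fun_prop), lintegral_const_mul _ (by fun_prop),
    lintegral_const_mul _ (by fun_prop)]
  refine (add_le_add (mul_le_mul_right hξ _) (mul_le_mul_right hη _)).trans ?_
  rw [← ENNReal.ofReal_mul (by positivity), ← ENNReal.ofReal_mul (by positivity),
    ← ENNReal.ofReal_add (by positivity) (by positivity)]
  refine ENNReal.ofReal_le_ofReal ?_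
  rw [div_mul_eq_mul_div, div_mul_eq_mul_div, ← Real.exp_add, ← Real.exp_add,
    show (v - u) / 2 + u = (u + v) / 2 by ring, show (u - v) / 2 + v = (u + v) / 2 by ring,
    add_halves]
  exact Real.exp_le_exp.2 (by linarith)

theorem logLaplace_zero_le [IsProbabilityMeasure μ] :
    logLaplace μ 0 ≤ ((0 : ℝ) : EReal) := by
  rw [logLaplace_le_iff]
  simp

theorem logLaplace_half_le [IsProbabilityMeasure μ] {ξ ζ : EuclideanSpace ℝ (Fin n)} {u v : ℝ}
    (hξ : logLaplace μ ξ ≤ (u : EReal)) (hζ : (2 : ℝ) • ζ = ξ) (hu : u ≤ 2 * v) :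
    logLaplace μ ζ ≤ (v : EReal) :=
  logLaplace_midpoint_le hξ logLaplace_zero_le (by simpa using hζ) (by simpa using hu)

/-- Jensen's inequality: the logarithmic Laplace transform of a centered measure is
nonnegative. -/
theorem nonneg_of_logLaplace_le [IsProbabilityMeasure μ] (hc : IsCentered μ)
    {ξ : EuclideanSpace ℝ (Fin n)} {u : ℝ} (h : logLaplace μ ξ ≤ (u : EReal)) : 0 ≤ u := by
  have hi := integrable_exp_of_logLaplace_le h
  rw [logLaplace_le_iff, ← ofReal_integral_eq_lintegral_ofReal hi
    (.of_forall fun _ => (Real.exp_pos _).le),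
    ENNReal.ofReal_le_ofReal_iff (Real.exp_pos _).le] at h
  have hl : Integrable (fun y => inner ℝ ξ y) μ := hc.1.const_inner ξ
  have h1 : ∫ y, (1 + inner ℝ ξ y) ∂μ = 1 := by
    rw [integral_add (integrable_const _) hl, integral_inner hc.1, hc.2]
    simp
  have h2 : ∫ y, (1 + inner ℝ ξ y) ∂μ ≤ ∫ y, Real.exp (inner ℝ ξ y) ∂μ :=
    integral_mono ((integrable_const _).add hl) hi fun y => by
      simpa [add_comm] using Real.add_one_le_exp (inner ℝ ξ y)
  exact Real.one_le_exp_iff.1 (by linarith)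

end LogLaplace

/-! ### Tilts -/

section Tilt

variable {n : ℕ} {μ : Measure (EuclideanSpace ℝ (Fin n))} [IsProbabilityMeasure μ]
  {x : EuclideanSpace ℝ (Fin n)}

theorem measurable_sub_tiltBarycenter (μ : Measure (EuclideanSpace ℝ (Fin n)))
    (x : EuclideanSpace ℝ (Fin n)) : Measurable fun y => y - tiltBarycenter μ x :=
  measurable_id.sub_const _

theorem isProbabilityMeasure_tilt (hi : Integrable (fun y => Real.exp (inner ℝ x y)) μ) :
    IsProbabilityMeasure (tilt μ x) := by
  have : IsProbabilityMeasure (expTilt μ x) := isProbabilityMeasure_tilted hi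
  exact Measure.isProbabilityMeasure_map (measurable_sub_tiltBarycenter μ x).aemeasurable

/-- Tilting translates the argument by `x` and subtracts the normalising constant `L`; recentering
subtracts the linear term `⟨z,b⟩`. -/
theorem logLaplace_tilt_le_iff (hi : Integrable (fun y => Real.exp (inner ℝ x y)) μ)
    {z : EuclideanSpace ℝ (Fin n)} {u : ℝ} :
    logLaplace (tilt μ x) z ≤ (u : EReal) ↔ logLaplace μ (x + z) ≤
      ((u + Real.log (∫ y, Real.exp (inner ℝ x y) ∂μ) + inner ℝ z (tiltBarycenter μ x) : ℝ) :
        EReal) := by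
  set L := Real.log (∫ y, Real.exp (inner ℝ x y) ∂μ) with hL
  set b := tiltBarycenter μ x with hb
  have hexp : ∫ y, Real.exp (inner ℝ x y) ∂μ = Real.exp L :=
    (Real.exp_log (integral_exp_pos hi)).symm
  have key : ∫⁻ y, ENNReal.ofReal (Real.exp (inner ℝ z y)) ∂(tilt μ x) =
      ENNReal.ofReal (Real.exp (-(L + inner ℝ z b))) *
        ∫⁻ y, ENNReal.ofReal (Real.exp (inner ℝ (x + z) y)) ∂μ := by
    rw [tilt, lintegral_map (by fun_prop) (measurable_sub_tiltBarycenter μ x), expTilt,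
      lintegral_tilted, ← lintegral_const_mul _ (by fun_prop), hexp]
    refine lintegral_congr fun y => ?_
    rw [← ENNReal.ofReal_mul (by positivity), ← ENNReal.ofReal_mul (by positivity),
      ← Real.exp_sub, ← Real.exp_add, ← Real.exp_add, inner_sub_right, inner_add_left, ← hb]
    ring_nf
  rw [logLaplace_le_iff, logLaplace_le_iff, key,
    show u + L + inner ℝ z b = (L + inner ℝ z b) + u by ring, Real.exp_add,
    ENNReal.ofReal_mul (Real.exp_pos _).le, Real.exp_neg,
    ENNReal.ofReal_inv_of_pos (Real.exp_pos _)]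
  exact ENNReal.inv_mul_le_iff (by simp [Real.exp_pos]) ENNReal.ofReal_ne_top

theorem IsLogConcave.isLogConcave_tilt (hμ : IsLogConcave μ) (x : EuclideanSpace ℝ (Fin n)) :
    IsLogConcave (tilt μ x) := by
  obtain ⟨ρ, hρm, ⟨hρ0, hρ⟩, rfl⟩ := hμ
  set μ := volume.withDensity fun x => ENNReal.ofReal (ρ x)
  set b := tiltBarycenter μ x with hb
  -- If the exponential is not integrable then `Z = 0`, and both the tilt and the proposed density
  -- vanish, so no integrability is needed.
  set Z := ∫ y, Real.exp (inner ℝ x y) ∂μ with hZ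
  have hZ0 : 0 ≤ Z := integral_nonneg fun y => (Real.exp_pos _).le
  refine ⟨fun y => ρ (y + b) * (Real.exp (inner ℝ x (y + b)) / Z), ?_, ⟨fun y => ?_, ?_⟩, ?_⟩
  · have := hρm.comp (measurable_add_const b)
    exact this.mul (by fun_prop)
  · exact mul_nonneg (hρ0 _) (by positivity)
  · intro y z s t hs ht hst
    have h1 := hρ (y + b) (z + b) s t hs ht hst
    have h2 : s • (y + b) + t • (z + b) = s • y + t • z + b := by
      rw [smul_add, smul_add, add_add_add_comm, ← add_smul, hst, one_smul]
    rw [h2] at h1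
    rw [Real.mul_rpow (hρ0 _) (by positivity), Real.mul_rpow (hρ0 _) (by positivity),
      mul_mul_mul_comm]
    refine mul_le_mul h1 (le_of_eq ?_) (by positivity) (hρ0 _)
    rw [Real.div_rpow (Real.exp_pos _).le hZ0, Real.div_rpow (Real.exp_pos _).le hZ0,
      div_mul_div_comm, ← Real.rpow_add_of_nonneg hZ0 hs.le ht.le, hst, Real.rpow_one,
      ← Real.exp_mul, ← Real.exp_mul, ← Real.exp_add, ← h2, inner_add_right x (s • _),
      inner_smul_right, inner_smul_right]
    ring_nf
  · have hmρ : Measurable fun y => ENNReal.ofReal (ρ y) := hρm.ennreal_ofReal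
    ext A hA
    rw [tilt, Measure.map_apply (measurable_sub_tiltBarycenter μ x) hA, expTilt,
      tilted_apply' _ _ (measurable_sub_tiltBarycenter μ x hA), withDensity_apply _ hA,
      setLIntegral_withDensity_eq_setLIntegral_mul _ hmρ (by fun_prop)
        (measurable_sub_tiltBarycenter μ x hA),
      ← (measurePreserving_add_right volume b).setLIntegral_comp_preimage_emb
        (MeasurableEquiv.addRight b).measurableEmbedding]
    have : (fun y => y + b) ⁻¹' ((fun y => y - tiltBarycenter μ x) ⁻¹' A) = A := by
      ext y; simp [hb]
    rw [this]
    refine lintegral_congr fun y => ?_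
    rw [Pi.mul_apply, ENNReal.ofReal_mul (hρ0 _)]

/-- The barycenter exists because `‖y‖ e^⟨x,y⟩ ≤ ‖y‖² + e^⟨2x,y⟩`. Finiteness at `2x` is what `x ∈ ½
Λ_p(μ)` provides. -/
theorem IsLogConcave.isCentered_tilt (hμ : IsLogConcave μ) (hint : Integrable (fun y => y) μ)
    (hi : Integrable (fun y => Real.exp (inner ℝ x y)) μ)
    (hi2 : Integrable (fun y => Real.exp (inner ℝ ((2 : ℝ) • x) y)) μ) :
    IsCentered (tilt μ x) := by
  have : IsProbabilityMeasure (expTilt μ x) := isProbabilityMeasure_tilted hi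
  have h1 : Integrable (fun y => y) (expTilt μ x) := by
    rw [expTilt, integrable_tilted_iff hi]
    refine ((hμ.integrable_norm_sq hint).add hi2).mono'
      (Measurable.aestronglyMeasurable (by fun_prop)) (.of_forall fun y => ?_)
    rw [norm_smul, Real.norm_of_nonneg (Real.exp_pos _).le, Pi.add_apply, real_inner_smul_left,
      two_mul, Real.exp_add]
    nlinarith [sq_nonneg (Real.exp (inner ℝ x y) - ‖y‖), sq_nonneg ‖y‖,
      sq_nonneg (Real.exp (inner ℝ x y))]
  have hm := (measurable_sub_tiltBarycenter μ x).aemeasurable (μ := expTilt μ x)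
  constructor
  · rw [tilt, integrable_map_measure (g := fun y => y) aestronglyMeasurable_id hm]
    exact h1.sub (integrable_const _)
  · rw [tilt, integral_map (f := fun y => y) hm aestronglyMeasurable_id,
      integral_sub h1 (integrable_const _)]
    simp [tiltBarycenter]

/-- The analytic facts on the tilt at a point of `½ Λ_p(μ)`. -/
theorem IsLogConcave.tilt_spec (hμ : IsLogConcave μ) (hc : IsCentered μ) {p : ℝ}
    (hx : x ∈ (1 / 2 : ℝ) • lambdaBody p μ) :
    Integrable (fun y => Real.exp (inner ℝ x y)) μ ∧ (2 : ℝ) • x ∈ lambdaBody p μ ∧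
      IsProbabilityMeasure (tilt μ x) ∧ IsLogConcave (tilt μ x) ∧ IsCentered (tilt μ x) := by
  obtain ⟨w, hw, rfl⟩ := hx
  have h2 : (2 : ℝ) • (1 / 2 : ℝ) • w = w := by simp [smul_smul]
  have hi := integrable_exp_of_logLaplace_le
    (logLaplace_half_le (v := p / 2) hw.1 h2 (by linarith))
  exact ⟨hi, by rwa [h2], isProbabilityMeasure_tilt hi, hμ.isLogConcave_tilt _,
    hμ.isCentered_tilt hc.1 hi (by rw [h2]; exact integrable_exp_of_logLaplace_le hw.1)⟩

theorem log_integral_exp_le {u : ℝ} (h : logLaplace μ x ≤ (u : EReal)) :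
    Real.log (∫ y, Real.exp (inner ℝ x y) ∂μ) ≤ u := by
  have hi := integrable_exp_of_logLaplace_le h
  rw [logLaplace_le_iff, ← ofReal_integral_eq_lintegral_ofReal hi
    (.of_forall fun _ => (Real.exp_pos _).le),
    ENNReal.ofReal_le_ofReal_iff (Real.exp_pos _).le] at h
  exact (Real.log_le_iff_le_exp (integral_exp_pos hi)).2 h

theorem mem_four_smul {K : Set (EuclideanSpace ℝ (Fin n))} {z : EuclideanSpace ℝ (Fin n)}
    (h : (1 / 4 : ℝ) • z ∈ K) : z ∈ (4 : ℝ) • K :=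
  ⟨_, h, by simp [smul_smul]⟩

/-- The points `x ± z/2` are midpoints of `2x` and `±z`, so `Λ_μ ≤ p` there, and the tilt has
transform at most `p - L ∓ l` at `±z/2`. Nonnegativity at `-z/2` gives `-l ≤ p - L`, hence at most
`2(p - L) ≤ 2p` at `z/2`; halving once more costs the second factor 2. -/
theorem lambdaBody_subset_tilt (hμ : IsLogConcave μ) (hc : IsCentered μ) {p : ℝ}
    (hx : x ∈ (1 / 2 : ℝ) • lambdaBody p μ) :
    lambdaBody p μ ⊆ (4 : ℝ) • lambdaBody p (tilt μ x) := by
  obtain ⟨hi, hx2, hprob, -, hcen⟩ := hμ.tilt_spec hc hx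
  set L := Real.log (∫ y, Real.exp (inner ℝ x y) ∂μ) with hL
  have hL0 : 0 ≤ L := by
    refine nonneg_of_logLaplace_le hc (ξ := x) ?_
    rw [logLaplace_le_iff, ← ofReal_integral_eq_lintegral_ofReal hi
      (.of_forall fun _ => (Real.exp_pos _).le), hL, Real.exp_log (integral_exp_pos hi)]
  have main : ∀ z, logLaplace μ z ≤ (p : EReal) → logLaplace μ (-z) ≤ (p : EReal) →
      logLaplace (tilt μ x) ((1 / 4 : ℝ) • z) ≤ (p : EReal) := by
    intro z hz hz'
    set l := inner ℝ ((1 / 2 : ℝ) • z) (tiltBarycenter μ x) with hl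
    have h1 : logLaplace μ (x + (1 / 2 : ℝ) • z) ≤ (p : EReal) :=
      logLaplace_midpoint_le hx2.1 hz (by module) (by linarith)
    have h2 : logLaplace μ (x + -((1 / 2 : ℝ) • z)) ≤ (p : EReal) :=
      logLaplace_midpoint_le hx2.1 hz' (by module) (by linarith)
    have h3 : logLaplace (tilt μ x) ((1 / 2 : ℝ) • z) ≤ ((p - L - l : ℝ) : EReal) := by
      rw [logLaplace_tilt_le_iff hi]
      convert h1 using 2
      ring
    have h4 : logLaplace (tilt μ x) (-((1 / 2 : ℝ) • z)) ≤ ((p - L + l : ℝ) : EReal) := by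
      rw [logLaplace_tilt_le_iff hi, inner_neg_left]
      convert h2 using 2
      ring
    have h5 := nonneg_of_logLaplace_le hcen h4
    exact logLaplace_half_le h3 (by module) (by linarith)
  exact fun z hz => mem_four_smul ⟨main z hz.1 hz.2, by
    simpa using main (-z) hz.2 (by simpa using hz.1)⟩

/-- Here `Λ_μ(x ± z) ≤ p + L ± ⟨z,b⟩`. Nonnegativity at `x - z` bounds `⟨z,b⟩` by `p + L`, so `Λ_μ(x
+ z) ≤ 2p + 2L ≤ 3p`. Averaging with `-x`, where `Λ_μ ≤ p/2`, removes the shift and leaves at most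
`2p` at `z/2`. -/
theorem lambdaBody_tilt_subset (hμ : IsLogConcave μ) (hc : IsCentered μ) {p : ℝ}
    (hx : x ∈ (1 / 2 : ℝ) • lambdaBody p μ) :
    lambdaBody p (tilt μ x) ⊆ (4 : ℝ) • lambdaBody p μ := by
  obtain ⟨hi, hx2, hprob, -, hcen⟩ := hμ.tilt_spec hc hx
  set L := Real.log (∫ y, Real.exp (inner ℝ x y) ∂μ) with hL
  have hLp : L ≤ p / 2 :=
    log_integral_exp_le (logLaplace_half_le hx2.1 rfl (by linarith))
  have hxn : logLaplace μ (-x) ≤ ((p / 2 : ℝ) : EReal) :=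
    logLaplace_half_le hx2.2 (by module) (by linarith)
  have main : ∀ z, logLaplace (tilt μ x) z ≤ (p : EReal) →
      logLaplace (tilt μ x) (-z) ≤ (p : EReal) → logLaplace μ ((1 / 4 : ℝ) • z) ≤ (p : EReal) := by
    intro z hz hz'
    rw [logLaplace_tilt_le_iff hi, ← hL] at hz hz'
    have h1 := nonneg_of_logLaplace_le hc hz'
    rw [inner_neg_left] at h1
    have hp0 := nonneg_of_logLaplace_le hc hx2.1
    have h2 : logLaplace μ ((1 / 2 : ℝ) • z) ≤ ((2 * p : ℝ) : EReal) :=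
      logLaplace_midpoint_le hz hxn (by module) (by linarith)
    exact logLaplace_half_le h2 (by module) le_rfl
  exact fun z hz => mem_four_smul ⟨main z hz.1 hz.2, by
    simpa using main (-z) hz.2 (by simpa using hz.1)⟩

end Tilt

/-! ### Centroid bodies -/

section CentroidBody

variable {n : ℕ} {μ ν : Measure (EuclideanSpace ℝ (Fin n))} [IsProbabilityMeasure μ]
  [IsProbabilityMeasure ν]

theorem centroidSupport_nonneg (p : ℝ) (μ : Measure (EuclideanSpace ℝ (Fin n)))
    (θ : EuclideanSpace ℝ (Fin n)) : 0 ≤ centroidSupport p μ θ :=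
  Real.rpow_nonneg (integral_nonneg fun _ => Real.rpow_nonneg (abs_nonneg _) _) _

theorem centroidSupport_smul {p : ℝ} (hp : 0 < p) (μ : Measure (EuclideanSpace ℝ (Fin n)))
    {t : ℝ} (ht : 0 ≤ t) (θ : EuclideanSpace ℝ (Fin n)) :
    centroidSupport p μ (t • θ) = t * centroidSupport p μ θ := by
  have h0 : 0 ≤ ∫ y, |inner ℝ y θ| ^ p ∂μ :=
    integral_nonneg fun _ => Real.rpow_nonneg (abs_nonneg _) _
  simp_rw [centroidSupport, inner_smul_right, abs_mul, abs_of_nonneg ht,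
    Real.mul_rpow ht (abs_nonneg _), integral_const_mul]
  rw [Real.mul_rpow (Real.rpow_nonneg ht _) h0, ← Real.rpow_mul ht, mul_one_div_cancel hp.ne',
    Real.rpow_one]

/-- Points of `Λ_p(μ)` have `h_{Z_p(μ)}` at most a multiple of `p`. -/
theorem centroidSupport_le_of_mem_lambdaBody {p : ℝ} (hp : 1 ≤ p)
    {θ : EuclideanSpace ℝ (Fin n)} (h : θ ∈ lambdaBody p μ) :
    centroidSupport p μ θ ≤ 6 * p := by
  have hp0 : 0 < p := by linarith
  have i1 := integrable_exp_of_logLaplace_le h.1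
  have i2 := integrable_exp_of_logLaplace_le (μ := μ) (ξ := -θ) h.2
  have hbd : ∀ {ξ : EuclideanSpace ℝ (Fin n)}, logLaplace μ ξ ≤ (p : EReal) →
      ∫ y, Real.exp (inner ℝ ξ y) ∂μ ≤ Real.exp p := by
    intro ξ h
    have := log_integral_exp_le h
    rwa [Real.log_le_iff_le_exp (integral_exp_pos (integrable_exp_of_logLaplace_le h))] at this
  have h1 : ∫ y, |inner ℝ y θ| ^ p ∂μ ≤ p ^ p * (2 * Real.exp p) := by
    calc ∫ y, |inner ℝ y θ| ^ p ∂μ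
        ≤ ∫ y, p ^ p * (Real.exp (inner ℝ θ y) + Real.exp (inner ℝ (-θ) y)) ∂μ := by
          refine integral_mono_of_nonneg (.of_forall fun y => Real.rpow_nonneg (abs_nonneg _) _)
            ((i1.add i2).const_mul _) (.of_forall fun y => ?_)
          refine (rpow_le_rpow_mul_exp (abs_nonneg _) hp0).trans ?_
          simp only [real_inner_comm θ y, inner_neg_left]
          refine mul_le_mul_of_nonneg_left ?_ (Real.rpow_nonneg hp0.le _)
          rcases abs_cases (inner ℝ θ y) with ⟨h, -⟩ | ⟨h, -⟩ <;> rw [h] <;>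
            linarith [Real.exp_pos (inner ℝ θ y), Real.exp_pos (-inner ℝ θ y)]
      _ = p ^ p * (∫ y, Real.exp (inner ℝ θ y) ∂μ + ∫ y, Real.exp (inner ℝ (-θ) y) ∂μ) := by
          rw [integral_const_mul, integral_add i1 i2]
      _ ≤ p ^ p * (2 * Real.exp p) := by
          refine mul_le_mul_of_nonneg_left ?_ (Real.rpow_nonneg hp0.le _)
          linarith [hbd h.1, hbd (ξ := -θ) h.2]
  have h2 : p ^ p * (2 * Real.exp p) ≤ (6 * p) ^ p := by
    have e2 : (2 : ℝ) ≤ 2 ^ p := by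
      simpa using Real.rpow_le_rpow_of_exponent_le one_le_two hp
    have e3 : Real.exp p ≤ 3 ^ p := by
      rw [← Real.exp_one_rpow]
      exact Real.rpow_le_rpow (Real.exp_pos _).le (by linarith [Real.exp_one_lt_d9]) hp0.le
    rw [mul_comm 6 p, Real.mul_rpow hp0.le (by norm_num), show (6 : ℝ) = 2 * 3 by norm_num,
      Real.mul_rpow two_pos.le three_pos.le]
    gcongr
  calc centroidSupport p μ θ ≤ ((6 * p) ^ p) ^ (1 / p) :=
        Real.rpow_le_rpow (integral_nonneg fun _ => Real.rpow_nonneg (abs_nonneg _) _)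
          (h1.trans h2) (by positivity)
    _ = 6 * p := by
      rw [← Real.rpow_mul (by positivity), mul_one_div_cancel hp0.ne', Real.rpow_one]

/-- For a log-concave measure, a point with `h_{Z_p(μ)} ≤ r` lies, after scaling, in `Λ_p(μ)`. -/
theorem smul_mem_lambdaBody_of_centroidSupport_le (hμ : IsLogConcave μ)
    (hint : Integrable (fun y => y) μ) {p r : ℝ} (hp : 1 ≤ p) (hr : 0 < r)
    {θ : EuclideanSpace ℝ (Fin n)} (h : centroidSupport p μ θ ≤ r) :
    (p / (4 * (Real.exp 3 * r))) • θ ∈ lambdaBody p μ := by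
  have hp0 : 0 < p := by linarith
  have hm := hμ.integrable_abs_rpow hint θ hp0
  have h0 : 0 ≤ ∫ y, |inner ℝ y θ| ^ p ∂μ :=
    integral_nonneg fun _ => Real.rpow_nonneg (abs_nonneg _) _
  have h1 : ∫ y, |inner ℝ y θ| ^ p ∂μ ≤ r ^ p := by
    have := Real.rpow_le_rpow (centroidSupport_nonneg p μ θ) h hp0.le
    rwa [centroidSupport, ← Real.rpow_mul h0, one_div_mul_cancel hp0.ne', Real.rpow_one] at this
  have key := hμ.lintegral_exp_le_of_moment θ hp hr (by
    rw [← ofReal_integral_eq_lintegral_ofReal hm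
      (.of_forall fun _ => Real.rpow_nonneg (abs_nonneg _) _)]
    simp_rw [real_inner_comm] at h1 ⊢
    exact ENNReal.ofReal_le_ofReal h1)
  have hk : 0 ≤ p / (4 * (Real.exp 3 * r)) := by positivity
  constructor
  · refine logLaplace_le_iff.2 (le_trans (lintegral_mono fun y => ?_) key)
    rw [real_inner_smul_left]
    gcongr
    exact le_abs_self _
  · refine logLaplace_le_iff.2 (le_trans (lintegral_mono fun y => ?_) key)
    rw [inner_neg_left, real_inner_smul_left, ← mul_neg]
    gcongr
    exact neg_le_abs _

/-- Duality reverses the inclusion. Scaling `θ` by `p / (4 e³ r)` puts it in `Λ_p(ν)`, hence in `4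
Λ_p(μ)`, where the bound `6p` applies; the constant is `6 · 4 · 4 e³`. -/
theorem centroidSupport_le_of_lambdaBody_subset (hν : IsLogConcave ν)
    (hint : Integrable (fun y => y) ν) {p : ℝ} (hp : 1 ≤ p)
    (h : lambdaBody p ν ⊆ (4 : ℝ) • lambdaBody p μ) (θ : EuclideanSpace ℝ (Fin n)) :
    centroidSupport p μ θ ≤ 96 * Real.exp 3 * centroidSupport p ν θ := by
  have hp0 : 0 < p := by linarith
  have key : ∀ r, 0 < r → centroidSupport p ν θ ≤ r →
      centroidSupport p μ θ ≤ 96 * Real.exp 3 * r := by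
    intro r hr hθ
    obtain ⟨z, hz, hzθ⟩ := h (smul_mem_lambdaBody_of_centroidSupport_le hν hint hp hr hθ)
    have hz' : θ = (4 * (4 * (Real.exp 3 * r)) / p) • z := by
      have : (4 : ℝ) • z = (p / (4 * (Real.exp 3 * r))) • θ := hzθ
      rw [mul_div_assoc, mul_comm, mul_smul, this, smul_smul, div_mul_div_cancel₀ hp0.ne',
        div_self (by positivity), one_smul]
    rw [hz', centroidSupport_smul hp0 μ (by positivity)]
    calc 4 * (4 * (Real.exp 3 * r)) / p * centroidSupport p μ z
        ≤ 4 * (4 * (Real.exp 3 * r)) / p * (6 * p) := by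
          gcongr
          exact centroidSupport_le_of_mem_lambdaBody hp hz
      _ = 96 * Real.exp 3 * r := by field_simp; norm_num
  -- The scaling needs `r > 0`, whereas the support function of `ν` may vanish (at `θ = 0`, say), so
  -- it is approached from above.
  refine le_of_forall_pos_le_add fun ε hε => ?_
  have hC : 0 < 96 * Real.exp 3 := by positivity
  have h0 := centroidSupport_nonneg p ν θ
  have := key (centroidSupport p ν θ + ε / (96 * Real.exp 3)) (by positivity)
    (by linarith [div_pos hε hC])
  rwa [mul_add, mul_div_cancel₀ _ hC.ne'] at this

end CentroidBody

theorem centroidBody_subset_smul {n : ℕ} {μ ν : Measure (EuclideanSpace ℝ (Fin n))} {p C : ℝ}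
    (hC : 0 < C) (h : ∀ θ, centroidSupport p μ θ ≤ C * centroidSupport p ν θ) :
    centroidBody p μ ⊆ C • centroidBody p ν := by
  intro z hz
  refine ⟨C⁻¹ • z, fun θ => ?_, smul_inv_smul₀ hC.ne' z⟩
  rw [real_inner_smul_left, inv_mul_le_iff₀ hC]
  exact (hz θ).trans (h θ)

/-- Puts the two symmetric inclusions into the required form, with `c = C⁻¹`. -/
theorem isoWith_of_subset_smul {n : ℕ} {C : ℝ} (hC : 0 < C)
    {K T : Set (EuclideanSpace ℝ (Fin n))}
    (h1 : K ⊆ C • T) (h2 : T ⊆ C • K) : IsoWith C⁻¹ C K T := by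
  refine ⟨?_, h2⟩
  rintro _ ⟨z, hz, rfl⟩
  obtain ⟨w, hw, rfl⟩ := h1 hz
  simpa [smul_smul, hC.ne'] using hw

end LogConcaveTilt

theorem mainTheorem9 :
    (∃ c C : ℝ, 0 < c ∧ 0 < C ∧
      ∀ (n : ℕ) (μ : MeasureTheory.Measure (EuclideanSpace ℝ (Fin n)))
        [MeasureTheory.IsProbabilityMeasure μ],
        LogConcaveTilt.IsLogConcave μ → LogConcaveTilt.IsCentered μ →
        ∀ p : ℝ, 0 ≤ p →
        ∀ x ∈ (1 / 2 : ℝ) • LogConcaveTilt.lambdaBody p μ,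
          LogConcaveTilt.IsoWith c C
            (LogConcaveTilt.lambdaBody p (LogConcaveTilt.tilt μ x))
            (LogConcaveTilt.lambdaBody p μ)) ∧
    (∃ c C : ℝ, 0 < c ∧ 0 < C ∧
      ∀ (n : ℕ) (μ : MeasureTheory.Measure (EuclideanSpace ℝ (Fin n)))
        [MeasureTheory.IsProbabilityMeasure μ],
        LogConcaveTilt.IsLogConcave μ → LogConcaveTilt.IsCentered μ →
        ∀ p : ℝ, 1 ≤ p →
        ∀ x ∈ (1 / 2 : ℝ) • LogConcaveTilt.lambdaBody p μ,
          LogConcaveTilt.IsoWith c C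
            (LogConcaveTilt.centroidBody p (LogConcaveTilt.tilt μ x))
            (LogConcaveTilt.centroidBody p μ)) := by
  refine ⟨⟨4⁻¹, 4, by norm_num, by norm_num, fun n μ _ hμ hc p _ x hx => ?_⟩,
    ⟨(96 * Real.exp 3)⁻¹, 96 * Real.exp 3, by positivity, by positivity,
      fun n μ _ hμ hc p hp x hx => ?_⟩⟩
  · exact LogConcaveTilt.isoWith_of_subset_smul four_pos
      (LogConcaveTilt.lambdaBody_tilt_subset hμ hc hx)
      (LogConcaveTilt.lambdaBody_subset_tilt hμ hc hx)
  · obtain ⟨-, -, hprob, hlc, hcen⟩ := hμ.tilt_spec hc hx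
    have hC : 0 < 96 * Real.exp 3 := by positivity
    exact LogConcaveTilt.isoWith_of_subset_smul hC
      (LogConcaveTilt.centroidBody_subset_smul hC
        (LogConcaveTilt.centroidSupport_le_of_lambdaBody_subset hμ hc.1 hp
          (LogConcaveTilt.lambdaBody_subset_tilt hμ hc hx)))
      (LogConcaveTilt.centroidBody_subset_smul hC
        (LogConcaveTilt.centroidSupport_le_of_lambdaBody_subset hlc hcen.1 hp
          (LogConcaveTilt.lambdaBody_tilt_subset hμ hc hx)))
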